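/- Let $d\ge 0$ and let $\Lambda=\bigoplus_p\Lambda^p$ be the real exterior algebra on $\theta^1,\dots,\theta^d$. On $\Lambda\otimes\mathbb R[Y^1,\dots,Y^d,Z^1,\dots,Z^d]$ put (with summation over $a$) $$t_1=Y^a\frac{\partial}{\partial Z^a},\quad t_0=Y^a\frac{\partial}{\partial Y^a}-Z^a\frac{\partial}{\partial Z^a},\quad \theta_Y=\theta^a\frac{\partial}{\partial Y^a},\quad \theta_Z=\theta^a\frac{\partial}{\partial Z^a},\quad \sigma_-=\theta_Z .$$ Let $V^p=\{F\in\Lambda^p\otimes\mathbb R[Y,Z] : t_1F=0\}$ be the space of $p$-forms valued in two-row $GL(d)$ Young diagrams (no trace conditions). Then $\sigma_-V^p\subset V^{p+1}$ and $\sigma_-^2=0$; let $H^p(\sigma_-)=\ker(\sigma_-|_{V^p})/\sigma_-(V^{p-1})$, with $V^{-1}=0$. For each $p\ge 0$ the space $R^p$ below consists of $\sigma_-$-closed elements of $V^p$, and every class in $H^p(\sigma_-)$ has exactly one representative in $R^p$ (that is, the natural map $R^p\to H^p(\sigma_-)$ is a linear isomorphism): 1. $R^0$ is the space of finite sums over $n\ge0$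 of zero-forms $F_{a(n)}Y^{a(n)}=F_{a_1\dots a_n}Y^{a_1}\cdots Y^{a_n}$ with $F_{a(n)}$ a real symmetric tensor of rank $n$. 2. $R^1$ is the space of finite sums over $n\ge0$ of one-forms $F_{a(n)c}\,\theta^cY^{a(n)}$ with $F_{a(n)c}$ a real totally symmetric tensor of rank $n+1$. 3. For every $p>1$, $R^p=\{\theta_Y\theta_Z C : C\in V^{p-2},\ t_0C=0\}$. -/

import Mathlib

open scoped TensorProduct

noncomputable section

namespace TwoRow

/-- Forms with constant coefficients in `d` Grassmann variables `θ^a`, valued in the polynomial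
ring `ℝ[Y, Z]`.  The variable `Sum.inl a` is `Y^a` and the variable `Sum.inr a` is `Z^a`. -/
abbrev Forms (d : ℕ) : Type :=
  ExteriorAlgebra ℝ (Fin d → ℝ) ⊗[ℝ] MvPolynomial (Fin d ⊕ Fin d) ℝ

/-- The Grassmann variable `θ^a`. -/
def theta {d : ℕ} (a : Fin d) : ExteriorAlgebra ℝ (Fin d → ℝ) :=
  ExteriorAlgebra.ι ℝ (Pi.single a 1)

/-- The variable `Y^a`. -/
def varY {d : ℕ} (a : Fin d) : MvPolynomial (Fin d ⊕ Fin d) ℝ := MvPolynomial.X (Sum.inl a)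

/-- The variable `Z^a`. -/
def varZ {d : ℕ} (a : Fin d) : MvPolynomial (Fin d ⊕ Fin d) ℝ := MvPolynomial.X (Sum.inr a)

/-- The partial derivative with respect to `Y^a`. -/
def dY {d : ℕ} (a : Fin d) : Module.End ℝ (MvPolynomial (Fin d ⊕ Fin d) ℝ) :=
  (MvPolynomial.pderiv (R := ℝ) (Sum.inl a)).toLinearMap

/-- The partial derivative with respect to `Z^a`. -/
def dZ {d : ℕ} (a : Fin d) : Module.End ℝ (MvPolynomial (Fin d ⊕ Fin d) ℝ) :=
  (MvPolynomial.pderiv (R := ℝ) (Sum.inr a)).toLinearMap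

/-- `t₁ = Y^a ∂/∂Z^a`. -/
def t1 (d : ℕ) : Module.End ℝ (Forms d) :=
  ∑ a : Fin d, TensorProduct.map LinearMap.id (LinearMap.mulLeft ℝ (varY a) ∘ₗ dZ a)

/-- `t₀ = Y^a ∂/∂Y^a - Z^a ∂/∂Z^a`. -/
def t0 (d : ℕ) : Module.End ℝ (Forms d) :=
  ∑ a : Fin d, TensorProduct.map LinearMap.id
    (LinearMap.mulLeft ℝ (varY a) ∘ₗ dY a - LinearMap.mulLeft ℝ (varZ a) ∘ₗ dZ a)

/-- `θ_Y = θ^a ∂/∂Y^a`. -/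
def thetaY (d : ℕ) : Module.End ℝ (Forms d) :=
  ∑ a : Fin d, TensorProduct.map (LinearMap.mulLeft ℝ (theta a)) (dY a)

/-- `θ_Z = θ^a ∂/∂Z^a`. -/
def thetaZ (d : ℕ) : Module.End ℝ (Forms d) :=
  ∑ a : Fin d, TensorProduct.map (LinearMap.mulLeft ℝ (theta a)) (dZ a)

/-- The differential `σ₋ = θ^a ∂/∂Z^a`. -/
def sigmaMinus (d : ℕ) : Module.End ℝ (Forms d) := thetaZ d

/-- The `p`-forms, `Λ^p ⊗ ℝ[Y, Z]`, as a subspace of all forms. -/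
def pForms (d p : ℕ) : Submodule ℝ (Forms d) :=
  LinearMap.range (TensorProduct.map (⋀[ℝ]^p (Fin d → ℝ)).subtype
    (LinearMap.id : Module.End ℝ (MvPolynomial (Fin d ⊕ Fin d) ℝ)))

/-- `V^p`: the `p`-forms valued in two-row Young diagrams, `t₁ F = 0`. -/
def V (d p : ℕ) : Submodule ℝ (Forms d) := pForms d p ⊓ LinearMap.ker (t1 d)

/-- The kernel of `σ₋ : V^p → V^{p+1}`. -/
def cocycles (d p : ℕ) : Submodule ℝ (Forms d) := V d p ⊓ LinearMap.ker (sigmaMinus d)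

/-- The image of `σ₋ : V^{p-1} → V^p` (zero for `p = 0`). -/
def coboundaries (d : ℕ) : ℕ → Submodule ℝ (Forms d)
  | 0 => ⊥
  | p + 1 => (V d p).map (sigmaMinus d)

theorem dZ_comm {d : ℕ} (a b : Fin d) (f : MvPolynomial (Fin d ⊕ Fin d) ℝ) :
    dZ a (dZ b f) = dZ b (dZ a f) := by
  have h : ⁅MvPolynomial.pderiv (R := ℝ) (Sum.inr a : Fin d ⊕ Fin d),
      MvPolynomial.pderiv (R := ℝ) (Sum.inr b : Fin d ⊕ Fin d)⁆ = 0 := by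
    apply MvPolynomial.derivation_ext
    intro i
    simp [Derivation.commutator_apply, MvPolynomial.pderiv_X, Pi.single_apply, apply_ite]
  have h2 := congrArg (fun D => D f) h
  simp only [Derivation.commutator_apply, Derivation.zero_apply] at h2
  exact sub_eq_zero.mp h2

theorem sigmaMinus_sq (d : ℕ) (F : Forms d) : sigmaMinus d (sigmaMinus d F) = 0 := by
  induction F using TensorProduct.induction_on with
  | zero => simp
  | add x y hx hy => simp [hx, hy]
  | tmul w f =>
    have key : sigmaMinus d (sigmaMinus d (w ⊗ₜ f)) =
        ∑ a : Fin d, ∑ b : Fin d, (theta b * (theta a * w)) ⊗ₜ[ℝ] dZ b (dZ a f) := by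
      simp [sigmaMinus, thetaZ, LinearMap.sum_apply]
    have swap : sigmaMinus d (sigmaMinus d (w ⊗ₜ f)) =
        -sigmaMinus d (sigmaMinus d (w ⊗ₜ f)) := by
      conv_lhs => rw [key, Finset.sum_comm]
      rw [key, ← Finset.sum_neg_distrib]
      refine Finset.sum_congr rfl fun a _ => ?_
      rw [← Finset.sum_neg_distrib]
      refine Finset.sum_congr rfl fun b _ => ?_
      have hanti : theta a * (theta b * w) = -(theta b * (theta a * w)) := by
        rw [← mul_assoc, ← mul_assoc, ← neg_mul]
        congr 1
        exact eq_neg_of_add_eq_zero_left (ExteriorAlgebra.ι_add_mul_swap _ _)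
      rw [hanti, dZ_comm a b, TensorProduct.neg_tmul]
    have two : (2 : ℝ) • sigmaMinus d (sigmaMinus d (w ⊗ₜ f)) = 0 := by
      rw [two_smul]
      nth_rewrite 1 [swap]
      exact neg_add_cancel _
    exact (smul_eq_zero.mp two).resolve_left two_ne_zero

theorem sigmaMinus_t1 (d : ℕ) (F : Forms d) :
    t1 d (sigmaMinus d F) = sigmaMinus d (t1 d F) := by
  induction F using TensorProduct.induction_on with
  | zero => simp
  | add x y hx hy => simp [hx, hy]
  | tmul w f =>
    simp only [sigmaMinus, thetaZ, t1, LinearMap.sum_apply, map_sum, TensorProduct.map_tmul,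
      LinearMap.id_apply, LinearMap.mulLeft_apply, LinearMap.comp_apply]
    rw [Finset.sum_comm]
    refine Finset.sum_congr rfl fun a _ => Finset.sum_congr rfl fun b _ => ?_
    have h : dZ b (varY a * dZ a f) = varY a * dZ a (dZ b f) := by
      rw [← dZ_comm b a]
      simp [dZ, varY]
    rw [h]

theorem sigmaMinus_mem_V {d p : ℕ} {F : Forms d} (hF : F ∈ V d p) :
    sigmaMinus d F ∈ V d (p + 1) := by
  refine ⟨?_, ?_⟩
  · obtain ⟨G, rfl⟩ := hF.1
    clear hF
    induction G using TensorProduct.induction_on with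
    | zero => simp
    | add x y hx hy => simpa using add_mem hx hy
    | tmul w f =>
      simp only [sigmaMinus, thetaZ, LinearMap.sum_apply, TensorProduct.map_tmul,
        LinearMap.id_apply, LinearMap.mulLeft_apply]
      refine sum_mem fun a _ => ?_
      have hw : theta a * (w : ExteriorAlgebra ℝ (Fin d → ℝ)) ∈ ⋀[ℝ]^(p + 1) (Fin d → ℝ) := by
        rw [ExteriorAlgebra.exteriorPower, pow_succ']
        exact Submodule.mul_mem_mul ⟨_, rfl⟩ w.2
      exact ⟨⟨_, hw⟩ ⊗ₜ dZ a f, rfl⟩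
  · have h : t1 d F = 0 := hF.2
    change t1 d (sigmaMinus d F) = 0
    rw [sigmaMinus_t1, h, map_zero]

theorem coboundaries_le_cocycles (d p : ℕ) : coboundaries d p ≤ cocycles d p := by
  cases p with
  | zero => exact bot_le
  | succ p =>
    rintro _ ⟨F, hF, rfl⟩
    exact ⟨sigmaMinus_mem_V hF, sigmaMinus_sq d F⟩

/-- The cohomology `Z / B` of a space `Z` of cocycles modulo a space `B` of coboundaries. -/
abbrev Cohomology {M : Type*} [AddCommGroup M] [Module ℝ M] (Z B : Submodule ℝ M) : Type _ :=
  Z ⧸ B.submoduleOf Z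

/-- The linear map `R → Z / B` that sends an element of `R ≤ Z` to its class. -/
def classMap {M : Type*} [AddCommGroup M] [Module ℝ M] (Z B R : Submodule ℝ M) (h : R ≤ Z) :
    R →ₗ[ℝ] Cohomology Z B :=
  (B.submoduleOf Z).mkQ ∘ₗ Submodule.inclusion h

/-- `H^p(σ₋) = ker(σ₋ : V^p → V^{p+1}) / im(σ₋ : V^{p-1} → V^p)`. -/
abbrev H (d p : ℕ) : Type := Cohomology (cocycles d p) (coboundaries d p)

/-- The space `R` of forms represents `H^p(σ₋)`: it consists of `σ₋`-closed elements of `V^p`,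
and sending an element of `R` to its class is a linear bijection `R → H^p(σ₋)`. -/
def Represents (d p : ℕ) (R : Submodule ℝ (Forms d)) : Prop :=
  ∃ h : R ≤ cocycles d p,
    Function.Bijective (classMap (cocycles d p) (coboundaries d p) R h : R → H d p)

/-- A tensor of rank `n` on `ℝ^d`, given by its components, is totally symmetric. -/
def IsSymmetric {d n : ℕ} (T : (Fin n → Fin d) → ℝ) : Prop :=
  ∀ (τ : Equiv.Perm (Fin n)) (a : Fin n → Fin d), T (a ∘ τ) = T a

/-- `F_{a(n)} Y^{a(n)}` for a tensor of rank `n`. -/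
def zeroForm {d n : ℕ} (T : (Fin n → Fin d) → ℝ) : Forms d :=
  ∑ a : Fin n → Fin d, T a • ((1 : ExteriorAlgebra ℝ (Fin d → ℝ)) ⊗ₜ[ℝ] ∏ i, varY (a i))

/-- `F_{a(n)c} θ^c Y^{a(n)}` for a tensor of rank `n + 1` (whose last index is `c`). -/
def oneForm {d n : ℕ} (T : (Fin (n + 1) → Fin d) → ℝ) : Forms d :=
  ∑ a : Fin n → Fin d, ∑ c : Fin d,
    T (Fin.snoc (α := fun _ => Fin d) a c) • (theta c ⊗ₜ[ℝ] ∏ i, varY (a i))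

/-- The (finite sums over `n` of) zero-forms `F_{a(n)} Y^{a(n)}`, with symmetric `F_{a(n)}`. -/
def symmetricZeroForms (d : ℕ) : Submodule ℝ (Forms d) :=
  Submodule.span ℝ {F | ∃ (n : ℕ) (T : (Fin n → Fin d) → ℝ), IsSymmetric T ∧ F = zeroForm T}

/-- The (finite sums over `n` of) one-forms `F_{a(n)c} θ^c Y^{a(n)}`, with totally symmetric
`F_{a(n)c}`. -/
def symmetricOneForms (d : ℕ) : Submodule ℝ (Forms d) :=
  Submodule.span ℝ
    {F | ∃ (n : ℕ) (T : (Fin (n + 1) → Fin d) → ℝ), IsSymmetric T ∧ F = oneForm T}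

/-- The forms `θ_Y θ_Z C` with `C ∈ V^q` and `t₀ C = 0`. -/
def rectangularForms (d q : ℕ) : Submodule ℝ (Forms d) :=
  (V d q ⊓ LinearMap.ker (t0 d)).map (thetaY d ∘ₗ thetaZ d)

end TwoRow

end

noncomputable section

namespace TwoRow

/-! Write X for either of the rows Y, Z. The operators `T` (X_i ∂/∂X_j), `Q` (θ ∂/∂X_i), `S` (X_i
∂/∂θ) and `formDegree` close under (anti)commutators into gl(2|1), and everything follows from these
relations. A cocycle may be taken bihomogeneous, of degree k in Y and l in Z. Since `t1` kills it,
it is a highest weight vector of gl(2), so k ≥ l or it vanishes (`eq_zero_of_lt`).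

For a p-form cocycle F, `exists_Q_eq` shows that (k-l)(l+p-1) F + S_Y Q_Y F is exact. As S_Y Q_Y
squares to k+p times itself (`S_Q_S_Q`), S_Y Q_Y F is itself exact when (k-l)(l+p-1) + k + p > 0, so
F is exact when k > l and l+p > 1. What survives in positive form degree is k = l, or p = 1 with l =
0. If k = l, then Q_Y F = 0 by weight, and `Q_Q_S_S` exhibits F as a multiple of Q_Y Q_Z (S_Y S_Z
F). If p = 1 and l = 0, the anticommutator of Q_Y and S_Y puts F in the image of Q_Y modulo exact
forms.

Representatives are unique for p ≥ 2 because they have `t0`-weight 0, whereas exact forms have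
weights at least 1. For p = 1 a short computation with S_Y does it, and for p = 0 there are no exact
forms. -/

variable {d : ℕ}

/-! ### Row derivations on polynomials -/

/-- The index of `Y^a` for `i = false` and of `Z^a` for `i = true`. -/
def rowVar (i : Bool) (a : Fin d) : Fin d ⊕ Fin d := if i then Sum.inr a else Sum.inl a

theorem rowVar_inj {i j : Bool} {a b : Fin d} : rowVar i a = rowVar j b ↔ i = j ∧ a = b := by
  cases i <;> cases j <;> simp [rowVar]

/-- The partial derivative in the variable `a` of the row `i`. -/
def rowDeriv (i : Bool) (a : Fin d) :
    Derivation ℝ (MvPolynomial (Fin d ⊕ Fin d) ℝ) (MvPolynomial (Fin d ⊕ Fin d) ℝ) :=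
  MvPolynomial.pderiv (rowVar i a)

theorem rowDeriv_X (i j : Bool) (a b : Fin d) :
    rowDeriv i a (MvPolynomial.X (rowVar j b)) = if i = j ∧ a = b then 1 else 0 := by
  simp only [rowDeriv, MvPolynomial.pderiv_X, Pi.single_apply, rowVar_inj]
  simp only [eq_comm]

theorem derivation_ext_rowVar
    {D E : Derivation ℝ (MvPolynomial (Fin d ⊕ Fin d) ℝ) (MvPolynomial (Fin d ⊕ Fin d) ℝ)}
    (h : ∀ i a, D (MvPolynomial.X (rowVar i a)) = E (MvPolynomial.X (rowVar i a))) : D = E := by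
  refine MvPolynomial.derivation_ext fun x => ?_
  rcases x with a | a
  · exact h false a
  · exact h true a

/-- The derivation that replaces the row `j` by the row `i`. -/
def rowShift (i j : Bool) :
    Derivation ℝ (MvPolynomial (Fin d ⊕ Fin d) ℝ) (MvPolynomial (Fin d ⊕ Fin d) ℝ) :=
  ∑ a : Fin d, (MvPolynomial.X (rowVar i a) : MvPolynomial (Fin d ⊕ Fin d) ℝ) • rowDeriv j a

theorem rowShift_apply (i j : Bool) (f : MvPolynomial (Fin d ⊕ Fin d) ℝ) :
    rowShift i j f = ∑ a : Fin d, MvPolynomial.X (rowVar i a) * rowDeriv j a f := by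
  have h := congrFun (map_sum Derivation.coeFnAddMonoidHom (fun a : Fin d =>
    (MvPolynomial.X (rowVar i a) : MvPolynomial (Fin d ⊕ Fin d) ℝ) • rowDeriv j a)
    Finset.univ) f
  rw [Finset.sum_apply] at h
  exact h

theorem rowShift_X (i j k : Bool) (a : Fin d) :
    rowShift i j (MvPolynomial.X (rowVar k a)) =
      if j = k then MvPolynomial.X (rowVar i a) else 0 := by
  rw [rowShift_apply]
  simp only [rowDeriv_X, ite_and]
  split_ifs <;> simp

theorem rowDeriv_comm (i j : Bool) (a b : Fin d) (f : MvPolynomial (Fin d ⊕ Fin d) ℝ) :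
    rowDeriv i a (rowDeriv j b f) = rowDeriv j b (rowDeriv i a f) := by
  have h : ⁅rowDeriv i a, rowDeriv j b⁆ = 0 := by
    refine derivation_ext_rowVar fun k c => ?_
    simp [Derivation.commutator_apply, rowDeriv_X, apply_ite]
  have h2 := congrArg (fun D => D f) h
  simp only [Derivation.commutator_apply, Derivation.zero_apply] at h2
  exact sub_eq_zero.mp h2

/-- The commutator of two derivations is a derivation, so it suffices to compare values on the
variables. -/
theorem rowShift_rowDeriv (i j k : Bool) (a : Fin d) (f : MvPolynomial (Fin d ⊕ Fin d) ℝ) :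
    rowShift i j (rowDeriv k a f) =
      rowDeriv k a (rowShift i j f) - if i = k then rowDeriv j a f else 0 := by
  have h : ⁅rowDeriv k a, rowShift i j⁆ = if i = k then rowDeriv j a else 0 := by
    refine derivation_ext_rowVar fun l c => ?_
    have hk : rowShift i j (rowDeriv k a (MvPolynomial.X (rowVar l c))) = 0 := by
      rw [rowDeriv_X]
      split_ifs <;> simp
    rw [Derivation.commutator_apply, hk, rowShift_X, sub_zero]
    by_cases h1 : i = k <;> by_cases h2 : j = l <;> simp [h1, h2, rowDeriv_X, eq_comm]
  have h2 := congrArg (fun D => D f) h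
  rw [Derivation.commutator_apply] at h2
  have h3 : (if i = k then rowDeriv j a else 0 : Derivation ℝ (MvPolynomial (Fin d ⊕ Fin d) ℝ)
    (MvPolynomial (Fin d ⊕ Fin d) ℝ)) f = if i = k then rowDeriv j a f else 0 := by
    split_ifs <;> simp
  rw [← h3, ← h2]
  abel

theorem rowShift_rowShift (i j k l : Bool) (f : MvPolynomial (Fin d ⊕ Fin d) ℝ) :
    rowShift i j (rowShift k l f) = rowShift k l (rowShift i j f) +
      (if j = k then rowShift i l f else 0) - if i = l then rowShift k j f else 0 := by
  rw [rowShift_apply k l f, map_sum]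
  simp only [Derivation.leibniz, rowShift_rowDeriv, rowShift_X, smul_eq_mul, mul_sub,
    Finset.sum_add_distrib, Finset.sum_sub_distrib]
  rw [rowShift_apply k l, rowShift_apply i l, rowShift_apply k j]
  split_ifs <;> simp [mul_comm] <;> abel

/-! ### Grassmann derivatives and form degree -/

/-- The left derivative with respect to `θ^a`. -/
def dTheta (a : Fin d) : Module.End ℝ (ExteriorAlgebra ℝ (Fin d → ℝ)) :=
  CliffordAlgebra.contractLeft (Q := (0 : QuadraticForm ℝ (Fin d → ℝ))) (LinearMap.proj a)

theorem dTheta_ι_mul (a : Fin d) (v : Fin d → ℝ) (w : ExteriorAlgebra ℝ (Fin d → ℝ)) :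
    dTheta a (ExteriorAlgebra.ι ℝ v * w) = v a • w - ExteriorAlgebra.ι ℝ v * dTheta a w :=
  CliffordAlgebra.contractLeft_ι_mul (Q := (0 : QuadraticForm ℝ (Fin d → ℝ)))
    (LinearMap.proj a) v w

theorem dTheta_theta_mul (a b : Fin d) (w : ExteriorAlgebra ℝ (Fin d → ℝ)) :
    dTheta a (theta b * w) = (if a = b then w else 0) - theta b * dTheta a w := by
  rw [theta, dTheta_ι_mul]
  by_cases h : a = b <;> simp [h]

theorem dTheta_dTheta (a b : Fin d) (w : ExteriorAlgebra ℝ (Fin d → ℝ)) :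
    dTheta a (dTheta b w) = -dTheta b (dTheta a w) :=
  CliffordAlgebra.contractLeft_comm _ _ w

theorem theta_mul_theta_mul (a b : Fin d) (w : ExteriorAlgebra ℝ (Fin d → ℝ)) :
    theta a * (theta b * w) = -(theta b * (theta a * w)) := by
  rw [← mul_assoc, ← mul_assoc, ← neg_mul]
  congr 1
  exact eq_neg_of_add_eq_zero_left (ExteriorAlgebra.ι_add_mul_swap _ _)

/-- The operator `θ^a ∂/∂θ^a`, which counts the form degree. -/
def thetaEuler (d : ℕ) : Module.End ℝ (ExteriorAlgebra ℝ (Fin d → ℝ)) :=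
  ∑ a : Fin d, LinearMap.mulLeft ℝ (theta a) ∘ₗ dTheta a

theorem thetaEuler_apply (w : ExteriorAlgebra ℝ (Fin d → ℝ)) :
    thetaEuler d w = ∑ a : Fin d, theta a * dTheta a w := by
  simp [thetaEuler]

theorem sum_smul_theta (v : Fin d → ℝ) : ∑ a, v a • theta a = ExteriorAlgebra.ι ℝ v := by
  conv_rhs => rw [← Finset.univ_sum_single v, map_sum]
  refine Finset.sum_congr rfl fun a _ => ?_
  rw [theta, ← map_smul, ← Pi.single_smul, smul_eq_mul, mul_one]

theorem thetaEuler_ι_mul (v : Fin d → ℝ) (w : ExteriorAlgebra ℝ (Fin d → ℝ)) :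
    thetaEuler d (ExteriorAlgebra.ι ℝ v * w) =
      ExteriorAlgebra.ι ℝ v * w + ExteriorAlgebra.ι ℝ v * thetaEuler d w := by
  have h (a : Fin d) : theta a * (ExteriorAlgebra.ι ℝ v * dTheta a w) =
      -(ExteriorAlgebra.ι ℝ v * (theta a * dTheta a w)) := by
    rw [← mul_assoc, ← mul_assoc, ← neg_mul]
    congr 1
    exact eq_neg_of_add_eq_zero_left (ExteriorAlgebra.ι_add_mul_swap _ _)
  simp only [thetaEuler_apply, dTheta_ι_mul, mul_sub, h, sub_neg_eq_add,
    Finset.sum_add_distrib, ← Finset.mul_sum]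
  congr 1
  rw [← sum_smul_theta v, Finset.sum_mul]
  simp

theorem thetaEuler_theta_mul (b : Fin d) (w : ExteriorAlgebra ℝ (Fin d → ℝ)) :
    thetaEuler d (theta b * w) = theta b * w + theta b * thetaEuler d w :=
  thetaEuler_ι_mul _ w

theorem thetaEuler_dTheta (b : Fin d) (w : ExteriorAlgebra ℝ (Fin d → ℝ)) :
    thetaEuler d (dTheta b w) = dTheta b (thetaEuler d w) - dTheta b w := by
  simp only [thetaEuler_apply, map_sum, dTheta_theta_mul, Finset.sum_sub_distrib,
    Finset.sum_ite_eq, Finset.mem_univ, if_true]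
  rw [sub_sub_cancel_left, ← Finset.sum_neg_distrib]
  refine Finset.sum_congr rfl fun a _ => ?_
  rw [dTheta_dTheta, mul_neg]

theorem thetaEuler_of_mem {p : ℕ} {w : ExteriorAlgebra ℝ (Fin d → ℝ)}
    (hw : w ∈ ⋀[ℝ]^p (Fin d → ℝ)) : thetaEuler d w = (p : ℝ) • w := by
  induction p generalizing w with
  | zero =>
    rw [ExteriorAlgebra.exteriorPower, pow_zero, Submodule.mem_one] at hw
    obtain ⟨r, rfl⟩ := hw
    rw [thetaEuler_apply]
    simp only [dTheta]
    simp [CliffordAlgebra.contractLeft_algebraMap]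
  | succ p ih =>
    rw [ExteriorAlgebra.exteriorPower, pow_succ'] at hw
    induction hw using Submodule.mul_induction_on' with
    | mem_mul_mem m hm n hn =>
      obtain ⟨v, rfl⟩ := hm
      rw [thetaEuler_ι_mul, ih hn, mul_smul_comm]
      push_cast
      rw [add_smul, one_smul, add_comm]
    | add x hx y hy h1 h2 => rw [map_add, h1, h2, smul_add]

/-! ### The gl(2|1) relations on forms -/

/-- `X_i^a ∂/∂X_j^a`, where `X_false = Y` and `X_true = Z`. -/
def T (d : ℕ) (i j : Bool) : Module.End ℝ (Forms d) :=
  TensorProduct.map LinearMap.id (rowShift i j).toLinearMap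

/-- `θ^a ∂/∂X_i^a`. -/
def Q (d : ℕ) (i : Bool) : Module.End ℝ (Forms d) :=
  ∑ a : Fin d, TensorProduct.map (LinearMap.mulLeft ℝ (theta a)) (rowDeriv i a).toLinearMap

/-- `X_i^a ∂/∂θ^a`. -/
def S (d : ℕ) (i : Bool) : Module.End ℝ (Forms d) :=
  ∑ a : Fin d, TensorProduct.map (dTheta a)
    (LinearMap.mulLeft ℝ (MvPolynomial.X (rowVar i a)))

/-- `θ^a ∂/∂θ^a`. -/
def formDegree (d : ℕ) : Module.End ℝ (Forms d) :=
  TensorProduct.map (thetaEuler d) LinearMap.id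

section Tmul

variable (w : ExteriorAlgebra ℝ (Fin d → ℝ)) (f : MvPolynomial (Fin d ⊕ Fin d) ℝ)

theorem T_tmul (i j : Bool) : T d i j (w ⊗ₜ f) = w ⊗ₜ rowShift i j f := rfl

theorem Q_tmul (i : Bool) :
    Q d i (w ⊗ₜ f) = ∑ a : Fin d, (theta a * w) ⊗ₜ[ℝ] rowDeriv i a f := by
  simp [Q, LinearMap.sum_apply]

theorem S_tmul (i : Bool) :
    S d i (w ⊗ₜ f) =
      ∑ a : Fin d, dTheta a w ⊗ₜ[ℝ] (MvPolynomial.X (rowVar i a) * f) := by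
  simp [S, LinearMap.sum_apply]

theorem formDegree_tmul : formDegree d (w ⊗ₜ f) = thetaEuler d w ⊗ₜ f := rfl

end Tmul

theorem t1_eq : t1 d = T d false true := by
  refine TensorProduct.ext' fun w f => ?_
  rw [T_tmul, rowShift_apply, TensorProduct.tmul_sum]
  simp [t1, LinearMap.sum_apply, rowVar, varY, dZ, rowDeriv]

theorem t0_eq : t0 d = T d false false - T d true true := by
  refine TensorProduct.ext' fun w f => ?_
  rw [LinearMap.sub_apply, T_tmul, T_tmul, rowShift_apply, rowShift_apply, ← TensorProduct.tmul_sub,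
    ← Finset.sum_sub_distrib, TensorProduct.tmul_sum]
  simp [t0, LinearMap.sum_apply, rowVar, varY, varZ, dY, dZ, rowDeriv]

theorem sigmaMinus_eq : sigmaMinus d = Q d true := rfl

theorem T_T (i j k l : Bool) (F : Forms d) :
    T d i j (T d k l F) = T d k l (T d i j F) +
      (if j = k then T d i l F else 0) - if i = l then T d k j F else 0 := by
  induction F using TensorProduct.induction_on with
  | zero => simp
  | add x y hx hy => simp only [map_add, hx, hy]; split_ifs <;> abel
  | tmul w f =>
    simp only [T_tmul, rowShift_rowShift i j k l f, TensorProduct.tmul_add, TensorProduct.tmul_sub]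
    split_ifs <;> simp

theorem T_Q (i j k : Bool) (F : Forms d) :
    T d i j (Q d k F) = Q d k (T d i j F) - if i = k then Q d j F else 0 := by
  induction F using TensorProduct.induction_on with
  | zero => simp
  | add x y hx hy => simp only [map_add, hx, hy]; split_ifs <;> abel
  | tmul w f =>
    simp only [Q_tmul, T_tmul, map_sum, rowShift_rowDeriv, TensorProduct.tmul_sub,
      Finset.sum_sub_distrib]
    split_ifs <;> simp

theorem T_S (i j k : Bool) (F : Forms d) :
    T d i j (S d k F) = S d k (T d i j F) + if j = k then S d i F else 0 := by
  induction F using TensorProduct.induction_on with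
  | zero => simp
  | add x y hx hy => simp only [map_add, hx, hy]; split_ifs <;> abel
  | tmul w f =>
    simp only [S_tmul, T_tmul, map_sum, Derivation.leibniz, rowShift_X, smul_eq_mul,
      TensorProduct.tmul_add, Finset.sum_add_distrib]
    split_ifs <;> simp [mul_comm]

theorem Q_Q (i j : Bool) (F : Forms d) : Q d i (Q d j F) = -Q d j (Q d i F) := by
  induction F using TensorProduct.induction_on with
  | zero => simp
  | add x y hx hy => simp only [map_add, hx, hy]; abel
  | tmul w f =>
    simp only [Q_tmul, map_sum, ← Finset.sum_neg_distrib]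
    rw [Finset.sum_comm]
    refine Finset.sum_congr rfl fun a _ => Finset.sum_congr rfl fun b _ => ?_
    rw [theta_mul_theta_mul, rowDeriv_comm, TensorProduct.neg_tmul]

theorem S_S (i j : Bool) (F : Forms d) : S d i (S d j F) = -S d j (S d i F) := by
  induction F using TensorProduct.induction_on with
  | zero => simp
  | add x y hx hy => simp only [map_add, hx, hy]; abel
  | tmul w f =>
    simp only [S_tmul, map_sum, ← Finset.sum_neg_distrib]
    rw [Finset.sum_comm]
    refine Finset.sum_congr rfl fun a _ => Finset.sum_congr rfl fun b _ => ?_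
    rw [dTheta_dTheta, mul_left_comm, TensorProduct.neg_tmul]

theorem Q_S (i j : Bool) (F : Forms d) :
    Q d i (S d j F) = T d j i F + (if i = j then formDegree d F else 0) - S d j (Q d i F) := by
  induction F using TensorProduct.induction_on with
  | zero => simp
  | add x y hx hy => simp only [map_add, hx, hy]; split_ifs <;> abel
  | tmul w f =>
    simp only [S_tmul, Q_tmul, T_tmul, formDegree_tmul, map_sum, Derivation.leibniz, rowDeriv_X,
      smul_eq_mul, dTheta_theta_mul, TensorProduct.tmul_add, TensorProduct.sub_tmul,
      Finset.sum_add_distrib, Finset.sum_sub_distrib]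
    have e1 : ∑ a : Fin d, ∑ b : Fin d, (if b = a then w else 0) ⊗ₜ[ℝ]
        (MvPolynomial.X (rowVar j b) * rowDeriv i a f) = w ⊗ₜ[ℝ] rowShift j i f := by
      rw [rowShift_apply, TensorProduct.tmul_sum]
      refine Finset.sum_congr rfl fun a _ => ?_
      rw [Finset.sum_eq_single a (fun b _ hb => by rw [if_neg hb, TensorProduct.zero_tmul])
        (by simp), if_pos rfl]
    have e2 : ∑ a : Fin d, ∑ b : Fin d, (theta b * dTheta a w) ⊗ₜ[ℝ]
        (f * if i = j ∧ b = a then 1 else 0) =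
        if i = j then thetaEuler d w ⊗ₜ[ℝ] f else 0 := by
      by_cases h : i = j
      · simp only [h, true_and, if_true, thetaEuler_apply, TensorProduct.sum_tmul]
        refine Finset.sum_congr rfl fun a _ => ?_
        rw [Finset.sum_eq_single a (fun b _ hb => by simp [hb]) (by simp), if_pos rfl, mul_one]
      · simp [h]
    rw [e1, e2, Finset.sum_comm]
    abel

theorem formDegree_T (i j : Bool) (F : Forms d) :
    formDegree d (T d i j F) = T d i j (formDegree d F) := by
  induction F using TensorProduct.induction_on with
  | zero => simp
  | add x y hx hy => simp only [map_add, hx, hy]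
  | tmul w f => rfl

theorem formDegree_Q (i : Bool) (F : Forms d) :
    formDegree d (Q d i F) = Q d i (formDegree d F) + Q d i F := by
  induction F using TensorProduct.induction_on with
  | zero => simp
  | add x y hx hy => simp only [map_add, hx, hy]; abel
  | tmul w f =>
    simp only [Q_tmul, formDegree_tmul, map_sum, thetaEuler_theta_mul, TensorProduct.add_tmul,
      Finset.sum_add_distrib]
    abel

theorem formDegree_S (i : Bool) (F : Forms d) :
    formDegree d (S d i F) = S d i (formDegree d F) - S d i F := by
  induction F using TensorProduct.induction_on with
  | zero => simp
  | add x y hx hy => simp only [map_add, hx, hy]; abel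
  | tmul w f =>
    simp only [S_tmul, formDegree_tmul, map_sum, thetaEuler_dTheta, TensorProduct.sub_tmul,
      Finset.sum_sub_distrib]

/-! ### Operators diagonalizable with natural eigenvalues -/

section Eigenspace

variable {M : Type*} [AddCommGroup M] [Module ℝ M] {A : Module.End ℝ M}

/-- Applying A - a removes the summand of index a and rescales the others by the nonzero factors n -
a, which drives the induction. -/
theorem mem_of_sum_eigenvectors_mem {W : Submodule ℝ M} (hW : ∀ F ∈ W, A F ∈ W)
    {g : ℕ → M} (hg : ∀ n, A (g n) = (n : ℝ) • g n) (s : Finset ℕ) (hs : ∑ n ∈ s, g n ∈ W) :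
    ∀ n ∈ s, g n ∈ W := by
  induction s using Finset.induction_on generalizing g with
  | empty => simp
  | insert a s ha ih =>
    have h1 : ∑ n ∈ s, ((n : ℝ) - a) • g n ∈ W := by
      have h := W.sub_mem (hW _ hs) (W.smul_mem (a : ℝ) hs)
      rw [Finset.sum_insert ha, map_add, map_sum, hg, smul_add, add_sub_add_left_eq_sub,
        Finset.smul_sum, ← Finset.sum_sub_distrib] at h
      convert h using 2 with n
      rw [hg, sub_smul]
    have h2 : ∀ n ∈ s, g n ∈ W := fun n hn => by
      have h := ih (g := fun n : ℕ => ((n : ℝ) - a) • g n)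
        (fun n => by rw [map_smul, hg, smul_comm]) h1 n hn
      refine (W.smul_mem_iff (sub_ne_zero.mpr ?_)).mp h
      exact Nat.cast_injective.ne (fun hna => ha (hna ▸ hn))
    intro n hn
    rcases Finset.mem_insert.mp hn with rfl | hn
    · rw [Finset.sum_insert ha] at hs
      exact (W.add_mem_iff_left (W.sum_mem h2)).mp hs
    · exact h2 n hn

theorem le_of_forall_eigenvector (hA : ⨆ n : ℕ, A.eigenspace (n : ℝ) = ⊤)
    {W U : Submodule ℝ M} (hW : ∀ F ∈ W, A F ∈ W)
    (h : ∀ F ∈ W, ∀ n : ℕ, A F = (n : ℝ) • F → F ∈ U) : W ≤ U := by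
  intro F hF
  have hm : F ∈ ⨆ n : ℕ, A.eigenspace (n : ℝ) := hA ▸ Submodule.mem_top
  obtain ⟨g, hg, rfl⟩ := (Submodule.mem_iSup_iff_exists_finsupp _ _).mp hm
  have hg' : ∀ n, A (g n) = (n : ℝ) • g n := fun n => Module.End.mem_eigenspace_iff.mp (hg n)
  exact U.sum_mem fun n hn =>
    h _ (mem_of_sum_eigenvectors_mem hW hg' g.support hF n hn) n (hg' n)

/-- Used whenever an operator would lower a polynomial or form degree below zero. -/
theorem eq_zero_of_eigenvalue_neg (hA : ⨆ n : ℕ, A.eigenspace (n : ℝ) = ⊤) {r : ℝ} (hr : r < 0)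
    {F : M} (hF : A F = r • F) : F = 0 := by
  have h := le_of_forall_eigenvector hA (W := A.eigenspace r) (U := ⊥)
    (fun G hG => by
      rw [Module.End.mem_eigenspace_iff.mp hG]
      exact Submodule.smul_mem _ _ hG)
    (fun G hG n hn => by
      rw [Module.End.mem_eigenspace_iff.mp hG] at hn
      have h0 : (r - n) • G = 0 := by rw [sub_smul, hn, sub_self]
      have hne : r - n ≠ 0 := by
        have : (0 : ℝ) ≤ n := n.cast_nonneg
        linarith
      exact (Submodule.mem_bot ℝ).mpr ((smul_eq_zero.mp h0).resolve_left hne))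
  exact (Submodule.mem_bot ℝ).mp (h (Module.End.mem_eigenspace_iff.mpr hF))

theorem eq_eigenspace_of_iSup_eq_top {W : ℕ → Submodule ℝ M}
    (hW : ∀ n, W n ≤ A.eigenspace (n : ℝ)) (ht : ⨆ n, W n = ⊤) (n : ℕ) :
    W n = A.eigenspace (n : ℝ) := by
  refine le_antisymm (hW n) fun F hF => ?_
  have hm : F ∈ ⨆ n, W n := ht ▸ Submodule.mem_top
  obtain ⟨g, hg, rfl⟩ := (Submodule.mem_iSup_iff_exists_finsupp _ _).mp hm
  refine Submodule.sum_mem _ fun k hk => ?_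
  have hg' : ∀ k, A (g k) = (k : ℝ) • g k :=
    fun k => Module.End.mem_eigenspace_iff.mp (hW k (hg k))
  have h := mem_of_sum_eigenvectors_mem (W := A.eigenspace (n : ℝ))
    (fun G hG => by
      rw [Module.End.mem_eigenspace_iff.mp hG]
      exact Submodule.smul_mem _ _ hG) hg' g.support hF k hk
  rw [Module.End.mem_eigenspace_iff, hg' k] at h
  by_cases hkn : k = n
  · exact hkn ▸ hg k
  · have h0 : ((k : ℝ) - n) • g k = 0 := by rw [sub_smul, h, sub_self]
    have hne : (k : ℝ) - n ≠ 0 := sub_ne_zero.mpr (by exact_mod_cast hkn)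
    rw [(smul_eq_zero.mp h0).resolve_left hne]
    exact zero_mem _

end Eigenspace

/-! ### Gradings by Y-degree, Z-degree and form degree -/

theorem rowShift_monomial (i : Bool) (s : Fin d ⊕ Fin d →₀ ℕ) (c : ℝ) :
    rowShift i i (MvPolynomial.monomial s c) =
      ((∑ a, s (rowVar i a) : ℕ) : ℝ) • MvPolynomial.monomial s c := by
  rw [rowShift_apply]
  simp only [rowDeriv, MvPolynomial.X_mul_pderiv_monomial, ← Finset.sum_smul, Nat.cast_smul_eq_nsmul]

theorem iSup_eigenspace_T (i : Bool) : ⨆ n : ℕ, (T d i i).eigenspace (n : ℝ) = ⊤ := by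
  rw [eq_top_iff, ← TensorProduct.span_tmul_eq_top, Submodule.span_le]
  rintro _ ⟨w, f, rfl⟩
  induction f using MvPolynomial.induction_on' with
  | monomial s c =>
    refine Submodule.mem_iSup_of_mem (∑ a, s (rowVar i a)) ?_
    rw [Module.End.mem_eigenspace_iff, T_tmul, rowShift_monomial, TensorProduct.tmul_smul]
  | add p q hp hq => rw [TensorProduct.tmul_add]; exact add_mem hp hq

theorem pForms_le_eigenspace (p : ℕ) : pForms d p ≤ (formDegree d).eigenspace (p : ℝ) := by
  rintro _ ⟨F, rfl⟩
  induction F using TensorProduct.induction_on with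
  | zero => simp
  | add x y hx hy => rw [map_add]; exact add_mem hx hy
  | tmul w f =>
    rw [Module.End.mem_eigenspace_iff, TensorProduct.map_tmul, formDegree_tmul,
      Submodule.subtype_apply, thetaEuler_of_mem w.2, TensorProduct.smul_tmul']

theorem iSup_pForms : ⨆ p, pForms d p = ⊤ := by
  rw [eq_top_iff, ← TensorProduct.span_tmul_eq_top, Submodule.span_le]
  rintro _ ⟨w, f, rfl⟩
  have hw : w ∈ ⨆ p : ℕ, ⋀[ℝ]^p (Fin d → ℝ) := by
    rw [(DirectSum.Decomposition.isInternal
      (fun p : ℕ => ⋀[ℝ]^p (Fin d → ℝ))).submodule_iSup_eq_top]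
    exact Submodule.mem_top
  induction hw using Submodule.iSup_induction' with
  | mem p w hw => exact Submodule.mem_iSup_of_mem p ⟨⟨w, hw⟩ ⊗ₜ f, rfl⟩
  | zero => rw [TensorProduct.zero_tmul]; exact zero_mem _
  | add x y _ _ hx hy => rw [TensorProduct.add_tmul]; exact add_mem hx hy

/-- Each side has an advantage: this turns membership in a tensor range into an equation that the
commutation relations can transport. -/
theorem pForms_eq (p : ℕ) : pForms d p = (formDegree d).eigenspace (p : ℝ) :=
  eq_eigenspace_of_iSup_eq_top pForms_le_eigenspace iSup_pForms p

theorem iSup_eigenspace_formDegree : ⨆ p : ℕ, (formDegree d).eigenspace (p : ℝ) = ⊤ := by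
  simp only [← pForms_eq, iSup_pForms]

theorem mem_V_iff {p : ℕ} {F : Forms d} :
    F ∈ V d p ↔ formDegree d F = (p : ℝ) • F ∧ T d false true F = 0 := by
  rw [V, Submodule.mem_inf, pForms_eq, Module.End.mem_eigenspace_iff, LinearMap.mem_ker, t1_eq]

theorem mem_cocycles_iff {p : ℕ} {F : Forms d} :
    F ∈ cocycles d p ↔
      formDegree d F = (p : ℝ) • F ∧ T d false true F = 0 ∧ Q d true F = 0 := by
  rw [cocycles, Submodule.mem_inf, mem_V_iff, LinearMap.mem_ker, sigmaMinus_eq, and_assoc]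

theorem le_of_forall_bihomogeneous {W U : Submodule ℝ (Forms d)}
    (hW : ∀ i, ∀ F ∈ W, T d i i F ∈ W)
    (h : ∀ F ∈ W, ∀ k l : ℕ, T d false false F = (k : ℝ) • F → T d true true F = (l : ℝ) • F →
      F ∈ U) : W ≤ U := by
  refine le_of_forall_eigenvector (iSup_eigenspace_T false) (hW false) fun F hF k hk => ?_
  have h2 := le_of_forall_eigenvector (iSup_eigenspace_T true)
    (W := W ⊓ (T d false false).eigenspace (k : ℝ)) (U := U)
    (fun G hG => ⟨hW true G hG.1, by
      have h3 := Module.End.mem_eigenspace_iff.mp hG.2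
      rw [SetLike.mem_coe, Module.End.mem_eigenspace_iff, T_T, h3, map_smul]
      simp⟩)
    (fun G hG l hl => h G hG.1 k l (Module.End.mem_eigenspace_iff.mp hG.2) hl)
  exact h2 ⟨hF, Module.End.mem_eigenspace_iff.mpr hk⟩

theorem T_mem_V (i : Bool) {p : ℕ} {F : Forms d} (hF : F ∈ V d p) : T d i i F ∈ V d p := by
  rw [mem_V_iff] at hF ⊢
  refine ⟨by rw [formDegree_T, hF.1, map_smul], ?_⟩
  cases i <;> simp [T_T false true, hF.2]

theorem T_mem_cocycles (i : Bool) {p : ℕ} {F : Forms d} (hF : F ∈ cocycles d p) :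
    T d i i F ∈ cocycles d p := by
  refine ⟨T_mem_V i hF.1, ?_⟩
  have h : Q d true F = 0 := hF.2
  have h2 := T_Q i i true F
  rw [h, map_zero] at h2
  change Q d true (T d i i F) = 0
  cases i <;> simpa [h, eq_comm] using h2

/-! ### Highest weight vectors and the homotopy -/

section Sl2

variable {F : Forms d} {k l p : ℝ}

theorem T_false_true_pow (h1 : T d false true F = 0)
    (hk : T d false false F = k • F) (hl : T d true true F = l • F) (n : ℕ) :
    T d false false ((T d true false ^ n) F) = (k - n) • (T d true false ^ n) F ∧
    T d true true ((T d true false ^ n) F) = (l + n) • (T d true false ^ n) F ∧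
    T d false true ((T d true false ^ (n + 1)) F) =
      ((n + 1) * (k - l - n)) • (T d true false ^ n) F := by
  induction n with
  | zero =>
    refine ⟨by simpa using hk, by simpa using hl, ?_⟩
    simp [T_T false true true false, h1, hk, hl]
    module
  | succ n ih =>
    obtain ⟨ih1, ih2, ih3⟩ := ih
    have e1 : T d false false ((T d true false ^ (n + 1)) F) =
        (k - (n + 1)) • (T d true false ^ (n + 1)) F := by
      rw [pow_succ', Module.End.mul_apply, T_T false false true false, ih1, map_smul]
      simp only [Bool.false_eq_true, if_false, if_true]
      module
    have e2 : T d true true ((T d true false ^ (n + 1)) F) =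
        (l + (n + 1)) • (T d true false ^ (n + 1)) F := by
      rw [pow_succ', Module.End.mul_apply, T_T true true true false, ih2, map_smul]
      simp only [Bool.true_eq_false, if_false, if_true]
      module
    refine ⟨by exact_mod_cast e1, by exact_mod_cast e2, ?_⟩
    rw [pow_succ' _ (n + 1), Module.End.mul_apply, T_T false true true false, ih3, if_pos rfl,
      if_pos rfl, e1, e2, map_smul, ← Module.End.mul_apply, ← pow_succ']
    push_cast
    module

/-- Enough lowerings make the Y-degree negative, hence give zero. Raising back step by step
multiplies by (n+1)(k-l-n), which is never zero when k < l, so F was already zero. -/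
theorem eq_zero_of_lt (h1 : T d false true F = 0)
    (hk : T d false false F = k • F) (hl : T d true true F = l • F) (hkl : k < l) : F = 0 := by
  obtain ⟨n, hn⟩ := exists_nat_gt k
  have h := T_false_true_pow h1 hk hl
  have hz : (T d true false ^ n) F = 0 :=
    eq_zero_of_eigenvalue_neg (iSup_eigenspace_T false) (sub_neg.mpr hn) (h n).1
  clear hn
  induction n with
  | zero => simpa using hz
  | succ n ih =>
    refine ih ?_
    have h3 := (h n).2.2
    rw [hz, map_zero] at h3
    have hn : (0 : ℝ) ≤ n := n.cast_nonneg
    refine (smul_eq_zero.mp h3.symm).resolve_left (mul_ne_zero (by linarith) (by linarith))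

/-- The homotopy of `σ₋` on highest weight vectors. -/
theorem exists_Q_eq (h1 : T d false true F = 0)
    (hk : T d false false F = k • F) (hl : T d true true F = l • F)
    (hp : formDegree d F = p • F) (hQ : Q d true F = 0) :
    ∃ G, formDegree d G = (p - 1) • G ∧ T d false true G = 0 ∧
      Q d true G = ((k - l) * (l + p - 1)) • F + S d false (Q d false F) := by
  have hy : T d false true (S d false F) = 0 := by simp [T_S, h1]
  -- S_Z F is not killed by `t1`, which sends it to S_Y F. The second term cancels this: S_Y F has
  -- weight (k+1, l), so raising its lowering gives k - l + 1 times itself.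
  refine ⟨(k - l + 1) • S d true F - T d true false (S d false F), ?_, ?_, ?_⟩
  · simp only [map_sub, map_smul, formDegree_T, formDegree_S, hp]
    module
  · have e1 : T d false true (T d true false (S d false F)) = (k - l + 1) • S d false F := by
      rw [T_T false true true false, hy]
      simp [T_S, hk, hl]
      module
    rw [map_sub, map_smul, e1]
    simp [T_S, h1]
  · have e1 : Q d true (S d true F) = (l + p) • F := by
      simp [Q_S, hl, hp, hQ, add_smul]
    have e2 : Q d true (T d true false (S d false F)) =
        (k + p) • F - S d false (Q d false F) := by
      have h := T_Q true false true (S d false F)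
      simp [Q_S, h1, hQ, hk, hp] at h
      rw [sub_eq_zero.mp h.symm]
      module
    rw [map_sub, map_smul, e1, e2]
    module

/-- Since Q_Y squares to zero, moving it past S_Y leaves only the anticommutator, Y-degree plus form
degree, evaluated on Q_Y F: (k-1) + (p+1). -/
theorem S_Q_S_Q (hk : T d false false F = k • F) (hp : formDegree d F = p • F) :
    S d false (Q d false (S d false (Q d false F))) = (k + p) • S d false (Q d false F) := by
  have h0 : Q d false (Q d false F) = 0 := by
    have h := Q_Q false false F
    have h2 : (2 : ℝ) • Q d false (Q d false F) = 0 := by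
      rw [two_smul]
      nth_rewrite 1 [h]
      exact neg_add_cancel _
    exact (smul_eq_zero.mp h2).resolve_left two_ne_zero
  rw [Q_S, h0, T_Q, formDegree_Q, hk, hp]
  simp
  module

theorem Q_Q_S_S (h1 : T d false true F = 0) (hl : T d false false F = l • F)
    (hl' : T d true true F = l • F) (hp : formDegree d F = p • F) (hZ : Q d true F = 0)
    (hY : Q d false F = 0) :
    Q d false (Q d true (S d false (S d true F))) = (-((l + p - 1) * (l + p))) • F := by
  have e1 : Q d true (S d true F) = (l + p) • F := by
    simp [Q_S, hl', hp, hZ, add_smul]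
  have e2 : Q d false (S d false F) = (l + p) • F := by
    simp [Q_S, hl, hp, hY, add_smul]
  have e3 : T d false true (S d true F) = S d false F := by simp [T_S, h1]
  rw [Q_S true false, e1, e3]
  simp only [Bool.true_eq_false, if_false, map_sub, map_add, map_smul, e2, map_zero]
  module

end Sl2

/-! ### Representatives as a complement of the coboundaries -/

theorem classMap_bijective {M : Type*} [AddCommGroup M] [Module ℝ M] {Z B R : Submodule ℝ M}
    (hR : R ≤ Z) (hd : Disjoint R B) (hs : Z ≤ R ⊔ B) :
    Function.Bijective (classMap Z B R hR) := by
  constructor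
  · refine (injective_iff_map_eq_zero _).mpr ?_
    rintro ⟨F, hF⟩ h
    have h2 : (⟨F, hR hF⟩ : Z) ∈ B.submoduleOf Z := (Submodule.Quotient.mk_eq_zero _).mp h
    exact Subtype.ext (Submodule.disjoint_def.mp hd F hF h2)
  · intro c
    obtain ⟨⟨F, hF⟩, rfl⟩ := Submodule.Quotient.mk_surjective _ c
    obtain ⟨r, hr, b, hb, rfl⟩ := Submodule.mem_sup.mp (hs hF)
    refine ⟨⟨r, hr⟩, (Submodule.Quotient.eq _).mpr ?_⟩
    change r - (r + b) ∈ B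
    rw [sub_add_cancel_left]
    exact neg_mem hb

theorem represents_of {p : ℕ} {R : Submodule ℝ (Forms d)} (hR : R ≤ cocycles d p)
    (hd : Disjoint R (coboundaries d p)) (hs : cocycles d p ≤ R ⊔ coboundaries d p) :
    Represents d p R :=
  ⟨hR, classMap_bijective hR hd hs⟩

/-! ### Zero-forms -/

section ZeroForms

theorem rowDeriv_true_prod_varY {n : ℕ} (b : Fin n → Fin d) (a : Fin d) :
    rowDeriv true a (∏ i, varY (b i)) = 0 := by
  refine Finset.prod_induction (fun i => varY (b i)) (fun f => rowDeriv true a f = 0)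
    (fun f g hf hg => ?_) (rowDeriv true a).map_one_eq_zero (fun i _ => ?_)
  · simp [Derivation.leibniz, hf, hg]
  · exact (rowDeriv_X true false a (b i)).trans (by simp)

theorem zeroForm_mem_cocycles {n : ℕ} (t : (Fin n → Fin d) → ℝ) :
    zeroForm t ∈ cocycles d 0 := by
  refine Submodule.sum_mem _ fun b _ => Submodule.smul_mem _ _ ?_
  have h1 : thetaEuler d 1 = 0 := by
    have h := thetaEuler_of_mem (d := d) (p := 0) (w := 1)
      (by rw [ExteriorAlgebra.exteriorPower, pow_zero]; exact Submodule.one_le.mp le_rfl)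
    simpa using h
  rw [mem_cocycles_iff]
  refine ⟨by simp [formDegree_tmul, h1], ?_, ?_⟩
  · simp [T_tmul, rowShift_apply, rowDeriv_true_prod_varY]
  · simp [Q_tmul, rowDeriv_true_prod_varY]

/-- The symmetrized indicator tensor of the multi-index b contracts to n! times the monomial, and n!
is invertible. -/
theorem one_tmul_prod_mem {n : ℕ} (b : Fin n → Fin d) :
    (1 : ExteriorAlgebra ℝ (Fin d → ℝ)) ⊗ₜ[ℝ] (∏ i, varY (b i)) ∈ symmetricZeroForms d := by
  have h : zeroForm (fun a : Fin n → Fin d =>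
      ∑ τ : Equiv.Perm (Fin n), if a = b ∘ τ then (1 : ℝ) else 0) =
      (n.factorial : ℝ) • ((1 : ExteriorAlgebra ℝ (Fin d → ℝ)) ⊗ₜ[ℝ] ∏ i, varY (b i)) := by
    simp only [zeroForm, Finset.sum_smul, ite_smul, one_smul, zero_smul]
    rw [Finset.sum_comm]
    have h2 : ∀ τ : Equiv.Perm (Fin n), ∏ i, varY ((b ∘ τ) i) = ∏ i, varY (b i) := fun τ =>
      Equiv.prod_comp τ fun i => varY (b i)
    simp only [Finset.sum_ite_eq', Finset.mem_univ, if_true, h2]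
    rw [Finset.sum_const, Finset.card_univ, Fintype.card_perm, Fintype.card_fin,
      Nat.cast_smul_eq_nsmul]
  have hn : (n.factorial : ℝ) ≠ 0 := by exact_mod_cast n.factorial_ne_zero
  refine ((symmetricZeroForms d).smul_mem_iff hn).mp ?_
  rw [← h]
  refine Submodule.subset_span ⟨n, _, fun ρ a => ?_, rfl⟩
  refine Fintype.sum_equiv (Equiv.mulRight ρ⁻¹) _ _ fun τ => ?_
  congr 1
  rw [eq_iff_iff, Equiv.coe_mulRight, Equiv.Perm.coe_mul, ← Function.comp_assoc,
    Equiv.Perm.inv_def, Equiv.eq_comp_symm]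

theorem rename_mem_span_prod_varY (g : MvPolynomial (Fin d) ℝ) :
    MvPolynomial.rename Sum.inl g ∈
      Submodule.span ℝ {f : MvPolynomial (Fin d ⊕ Fin d) ℝ |
        ∃ (n : ℕ) (b : Fin n → Fin d), f = ∏ i, varY (b i)} := by
  induction g using MvPolynomial.induction_on with
  | C r =>
    rw [MvPolynomial.rename_C, ← mul_one (MvPolynomial.C r), ← MvPolynomial.smul_eq_C_mul]
    exact Submodule.smul_mem _ _ (Submodule.subset_span ⟨0, Fin.elim0, by simp⟩)
  | add p q hp hq => rw [map_add]; exact add_mem hp hq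
  | mul_X p a hp =>
    rw [map_mul, MvPolynomial.rename_X]
    generalize MvPolynomial.rename Sum.inl p = q at hp
    induction hp using Submodule.span_induction with
    | mem f hf =>
      obtain ⟨n, b, rfl⟩ := hf
      refine Submodule.subset_span ⟨n + 1, Fin.snoc b a, ?_⟩
      simp [Fin.prod_univ_castSucc, varY]
    | zero => simp
    | add x y _ _ hx hy => rw [add_mul]; exact add_mem hx hy
    | smul r x _ hx => rw [smul_mul_assoc]; exact Submodule.smul_mem _ _ hx

theorem coeff_rowShift (i : Bool) (s : Fin d ⊕ Fin d →₀ ℕ)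
    (f : MvPolynomial (Fin d ⊕ Fin d) ℝ) :
    (rowShift i i f).coeff s = (∑ a, s (rowVar i a) : ℕ) * f.coeff s := by
  induction f using MvPolynomial.induction_on' with
  | monomial t c =>
    rw [rowShift_monomial, MvPolynomial.coeff_smul, MvPolynomial.coeff_monomial, smul_eq_mul]
    split_ifs with h
    · rw [h]
    · simp
  | add p q hp hq => rw [map_add, MvPolynomial.coeff_add, hp, hq, MvPolynomial.coeff_add, mul_add]

theorem exists_rename_of_rowShift_eq_zero {f : MvPolynomial (Fin d ⊕ Fin d) ℝ}
    (hf : rowShift true true f = 0) : ∃ g : MvPolynomial (Fin d) ℝ,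
      MvPolynomial.rename Sum.inl g = f := by
  refine MvPolynomial.exists_rename_eq_of_vars_subset_range f Sum.inl Sum.inl_injective ?_
  intro x hx
  obtain ⟨s, hs, hxs⟩ := (MvPolynomial.mem_vars_iff_mem_support x).mp hx
  rcases x with a | a
  · exact ⟨a, rfl⟩
  · exfalso
    -- Each coefficient is multiplied by the Z-degree of its monomial, so a monomial present in f
    -- has no Z.
    have h := coeff_rowShift true s f
    rw [hf, MvPolynomial.coeff_zero, eq_comm, mul_eq_zero, Nat.cast_eq_zero,
      Finset.sum_eq_zero_iff] at h
    rcases h with h | h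
    · exact Finsupp.mem_support_iff.mp hxs (h a (Finset.mem_univ a))
    · exact MvPolynomial.mem_support_iff.mp hs h

theorem exists_one_tmul_of_mem_pForms_zero {F : Forms d} (hF : F ∈ pForms d 0) :
    ∃ f : MvPolynomial (Fin d ⊕ Fin d) ℝ, F = 1 ⊗ₜ f := by
  obtain ⟨G, rfl⟩ := hF
  induction G using TensorProduct.induction_on with
  | zero => exact ⟨0, by rw [LinearMap.map_zero, TensorProduct.tmul_zero]⟩
  | add x y hx hy =>
    obtain ⟨f, hf⟩ := hx
    obtain ⟨g, hg⟩ := hy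
    exact ⟨f + g, by rw [map_add, hf, hg, TensorProduct.tmul_add]⟩
  | tmul w f =>
    obtain ⟨w, hw⟩ := w
    have hw' := hw
    rw [ExteriorAlgebra.exteriorPower, pow_zero, Submodule.mem_one] at hw'
    obtain ⟨r, rfl⟩ := hw'
    refine ⟨r • f, ?_⟩
    rw [TensorProduct.map_tmul, Submodule.subtype_apply, LinearMap.id_apply,
      ← TensorProduct.smul_tmul, ← Algebra.algebraMap_eq_smul_one]

theorem eq_zero_of_one_tmul_eq_zero {f : MvPolynomial (Fin d ⊕ Fin d) ℝ}
    (h : (1 : ExteriorAlgebra ℝ (Fin d → ℝ)) ⊗ₜ[ℝ] f = 0) : f = 0 := by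
  -- Projecting the exterior algebra to scalars is a left inverse of f ↦ 1 ⊗ f.
  have h2 := congrArg (fun x => TensorProduct.lid ℝ _ (TensorProduct.map
    (ExteriorAlgebra.algebraMapInv (R := ℝ) (M := Fin d → ℝ)).toLinearMap LinearMap.id x)) h
  simpa using h2

theorem S_eq_zero_of_formDegree_eq_zero {F : Forms d} (hF : formDegree d F = 0) (i : Bool) :
    S d i F = 0 :=
  eq_zero_of_eigenvalue_neg iSup_eigenspace_formDegree (neg_one_lt_zero (R := ℝ))
    (by rw [formDegree_S, hF, map_zero, zero_sub, neg_one_smul])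

/-- On a closed zero-form the anticommutator of Q_Z and S_Z vanishes, and there it equals the
Z-degree; so closed zero-forms are exactly the polynomials in Y. -/
theorem symmetricZeroForms_eq : symmetricZeroForms d = cocycles d 0 := by
  refine le_antisymm ?_ fun F hF => ?_
  · rw [symmetricZeroForms, Submodule.span_le]
    rintro _ ⟨n, t, -, rfl⟩
    exact zeroForm_mem_cocycles t
  · obtain ⟨h1, -, h3⟩ := mem_cocycles_iff.mp hF
    rw [Nat.cast_zero, zero_smul] at h1
    have h4 := Q_S true true F
    rw [S_eq_zero_of_formDegree_eq_zero h1, h1, h3] at h4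
    obtain ⟨f, rfl⟩ := exists_one_tmul_of_mem_pForms_zero hF.1.1
    have h5 : rowShift true true f = 0 := eq_zero_of_one_tmul_eq_zero (by
      simpa [T_tmul, eq_comm] using h4)
    obtain ⟨g, rfl⟩ := exists_rename_of_rowShift_eq_zero h5
    have hg := Submodule.mem_map_of_mem (f := TensorProduct.mk ℝ
      (ExteriorAlgebra ℝ (Fin d → ℝ)) _ 1) (rename_mem_span_prod_varY g)
    refine (Submodule.map_span_le _ _ _).mpr ?_ hg
    rintro _ ⟨n, b, rfl⟩
    exact one_tmul_prod_mem b

end ZeroForms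

/-! ### One-forms as the image of Q_Y -/

section OneForms

theorem derivation_prod_fin (D : Derivation ℝ (MvPolynomial (Fin d ⊕ Fin d) ℝ)
    (MvPolynomial (Fin d ⊕ Fin d) ℝ)) {n : ℕ}
    (f : Fin (n + 1) → MvPolynomial (Fin d ⊕ Fin d) ℝ) :
    D (∏ i, f i) = ∑ i, D (f i) * ∏ j, f (i.succAbove j) := by
  induction n with
  | zero => simp
  | succ n ih =>
    rw [Fin.prod_univ_succ, Derivation.leibniz, ih, smul_eq_mul, smul_eq_mul,
      add_comm, mul_comm (∏ i : Fin (n + 1), f i.succ), Finset.mul_sum,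
      Fin.sum_univ_succ (n := n + 1)]
    refine congrArg₂ _ rfl (Finset.sum_congr rfl fun i _ => ?_)
    rw [Fin.prod_univ_succ (fun j => f (i.succ.succAbove j)), Fin.succ_succAbove_zero]
    simp only [Fin.succ_succAbove_succ]
    ring

/-- Lets a symmetric tensor ignore which slot the differentiated index occupied. -/
theorem insertNth_eq_snoc_comp {n : ℕ} (p : Fin (n + 1)) (c : Fin d) (a : Fin n → Fin d) :
    (p.insertNth (α := fun _ => Fin d) c a) =
      Fin.snoc (α := fun _ => Fin d) a c ∘
        ((finSuccEquiv' p).trans finSuccEquivLast.symm : Equiv.Perm (Fin (n + 1))) := by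
  funext i
  refine Fin.succAboveCases p ?_ (fun j => ?_) i
  · simp
  · simp

/-- By the Leibniz rule there is one term for each of the n + 1 slots, and symmetry makes them
equal. -/
theorem Q_zeroForm {n : ℕ} {t : (Fin (n + 1) → Fin d) → ℝ} (ht : IsSymmetric t) :
    Q d false (zeroForm t) = ((n : ℝ) + 1) • oneForm t := by
  have h (a : Fin (n + 1) → Fin d) : Q d false
      ((1 : ExteriorAlgebra ℝ (Fin d → ℝ)) ⊗ₜ[ℝ] ∏ i, varY (a i)) =
      ∑ i, theta (a i) ⊗ₜ[ℝ] ∏ j, varY (a (i.succAbove j)) := by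
    simp only [Q_tmul, mul_one, derivation_prod_fin, TensorProduct.tmul_sum]
    rw [Finset.sum_comm]
    refine Finset.sum_congr rfl fun i _ => ?_
    have hX (c : Fin d) : rowDeriv false c (varY (a i)) = if c = a i then 1 else 0 :=
      (rowDeriv_X false false c (a i)).trans (by simp)
    rw [Finset.sum_eq_single (a i) (fun c _ hc => by simp [hX, hc]) (by simp), hX, if_pos rfl,
      one_mul]
  simp only [zeroForm, map_sum, map_smul, h, Finset.smul_sum]
  rw [Finset.sum_comm]
  have h2 (i : Fin (n + 1)) : ∑ a : Fin (n + 1) → Fin d,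
      t a • (theta (a i) ⊗ₜ[ℝ] ∏ j, varY (a (i.succAbove j)) : Forms d) = oneForm t := by
    rw [oneForm, Finset.sum_comm, ← Fintype.sum_prod_type']
    refine (Fintype.sum_equiv (Fin.insertNthEquiv (fun _ => Fin d) i) _ _ fun x => ?_).symm
    have hx : t (i.insertNth (α := fun _ => Fin d) x.1 x.2) =
        t (Fin.snoc (α := fun _ => Fin d) x.2 x.1) := by
      rw [insertNth_eq_snoc_comp, ht]
    simp [Fin.insertNthEquiv, hx]
  simp [h2, ← Nat.cast_smul_eq_nsmul ℝ]

theorem symmetricOneForms_eq :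
    symmetricOneForms d = (cocycles d 0).map (Q d false) := by
  rw [← symmetricZeroForms_eq]
  refine le_antisymm ?_ ?_
  · rw [symmetricOneForms, Submodule.span_le]
    rintro _ ⟨n, t, ht, rfl⟩
    have hn : (n : ℝ) + 1 ≠ 0 := by positivity
    refine (Submodule.smul_mem_iff _ hn).mp ?_
    rw [← Q_zeroForm ht]
    exact Submodule.mem_map_of_mem (Submodule.subset_span ⟨_, t, ht, rfl⟩)
  · rw [Submodule.map_le_iff_le_comap, symmetricZeroForms, Submodule.span_le]
    rintro _ ⟨n, t, ht, rfl⟩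
    change Q d false (zeroForm t) ∈ symmetricOneForms d
    cases n with
    | zero => simp [zeroForm, Q_tmul]
    | succ n =>
      rw [Q_zeroForm ht]
      exact Submodule.smul_mem _ _ (Submodule.subset_span ⟨n, t, ht, rfl⟩)

end OneForms

/-! ### Exactness and the three families of representatives -/

section Representatives

variable {p : ℕ} {F : Forms d} {k l : ℝ}

theorem smul_add_mem_coboundaries (hF : F ∈ cocycles d (p + 1))
    (hk : T d false false F = k • F) (hl : T d true true F = l • F) :
    ((k - l) * (l + p)) • F + S d false (Q d false F) ∈ coboundaries d (p + 1) := by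
  obtain ⟨h1, h2, h3⟩ := mem_cocycles_iff.mp hF
  obtain ⟨G, hG1, hG2, hG3⟩ := exists_Q_eq h2 hk hl h1 h3
  refine ⟨G, mem_V_iff.mpr ⟨by simpa using hG1, hG2⟩, ?_⟩
  rw [sigmaMinus_eq, hG3]
  push_cast
  rw [add_sub_assoc, add_sub_cancel_right]

theorem S_Q_mem_cocycles (hF : F ∈ cocycles d p) :
    S d false (Q d false F) ∈ cocycles d p := by
  obtain ⟨h1, h2, h3⟩ := mem_cocycles_iff.mp hF
  have e1 : T d false true (Q d false F) = 0 := by simp [T_Q, h2, h3]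
  refine mem_cocycles_iff.mpr ⟨?_, ?_, ?_⟩
  · rw [formDegree_S, formDegree_Q, h1]
    simp
  · simp [T_S, e1]
  · simp [Q_S, e1, Q_Q true false, h3]

/-- S_Y Q_Y F is a cocycle of the same bidegree, so the homotopy formula applies to it too; there
S_Y Q_Y acts as the scalar k + p + 1, making the total factor the one assumed positive. -/
theorem S_Q_mem_coboundaries (hF : F ∈ cocycles d (p + 1))
    (hk : T d false false F = k • F) (hl : T d true true F = l • F)
    (h : 0 < (k - l) * (l + p) + (k + p + 1)) :
    S d false (Q d false F) ∈ coboundaries d (p + 1) := by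
  have h1 := smul_add_mem_coboundaries (S_Q_mem_cocycles hF) (k := k) (l := l)
    (by rw [T_S, T_Q, hk]; simp) (by rw [T_S, T_Q, hl]; simp)
  rw [S_Q_S_Q hk (mem_cocycles_iff.mp hF).1, ← add_smul] at h1
  refine (Submodule.smul_mem_iff _ ?_).mp h1
  push_cast
  linarith

theorem mem_coboundaries_of_lt (hF : F ∈ cocycles d (p + 1))
    (hk : T d false false F = k • F) (hl : T d true true F = l • F)
    (hlk : l < k) (hlp : 0 < l + p) : F ∈ coboundaries d (p + 1) := by
  have h0 : 0 < (k - l) * (l + p) := mul_pos (sub_pos.mpr hlk) hlp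
  have h1 := smul_add_mem_coboundaries hF hk hl
  rw [Submodule.add_mem_iff_left _ (S_Q_mem_coboundaries hF hk hl (by
    have : (0 : ℝ) ≤ p := p.cast_nonneg
    linarith))] at h1
  exact (Submodule.smul_mem_iff _ h0.ne').mp h1

/-- Q_Y F is again killed by `t1`, but its weight (l-1, l) is not dominant. -/
theorem Q_false_eq_zero (hF : F ∈ cocycles d p)
    (hk : T d false false F = l • F) (hl : T d true true F = l • F) : Q d false F = 0 := by
  obtain ⟨h1, h2, h3⟩ := mem_cocycles_iff.mp hF
  refine eq_zero_of_lt (k := l - 1) (l := l) (by simp [T_Q, h2, h3]) ?_ ?_ (by linarith)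
  · rw [T_Q, hk]; simp; module
  · rw [T_Q, hl]; simp

theorem le_of_mem_V (hF : F ∈ V d p) (hk : T d false false F = k • F)
    (hl : T d true true F = l • F) (h0 : F ≠ 0) : l ≤ k :=
  not_lt.mp fun h => h0 (eq_zero_of_lt (mem_V_iff.mp hF).2 hk hl h)

theorem represents_zero : Represents d 0 (symmetricZeroForms d) :=
  represents_of symmetricZeroForms_eq.le (by simp [coboundaries])
    (symmetricZeroForms_eq.ge.trans le_sup_left)

theorem represents_one : Represents d 1 (symmetricOneForms d) := by
  rw [symmetricOneForms_eq]
  refine represents_of ?_ ?_ ?_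
  · rintro _ ⟨f, hf, rfl⟩
    obtain ⟨h1, h2, h3⟩ := mem_cocycles_iff.mp hf
    refine mem_cocycles_iff.mpr ⟨?_, by simp [T_Q, h2, h3], by simp [Q_Q true false, h3]⟩
    rw [formDegree_Q, h1]
    simp
  · rw [Submodule.disjoint_def]
    rintro _ ⟨f, hf, rfl⟩ ⟨G, hG, hGF⟩
    obtain ⟨h1, h2, h3⟩ := mem_cocycles_iff.mp hf
    obtain ⟨g1, g2⟩ := mem_V_iff.mp hG
    rw [Nat.cast_zero, zero_smul] at h1 g1
    rw [sigmaMinus_eq] at hGF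
    -- S_Y anticommutes with Q_Z up to `t1`, which kills G, and S_Y kills zero-forms. Hence f has
    -- Y-degree 0, and Q_Y f would have Y-degree -1.
    have e1 : S d false (Q d true G) = 0 := by
      have h := Q_S true false G
      rw [S_eq_zero_of_formDegree_eq_zero g1, g2] at h
      simpa using h
    have e2 : T d false false f = 0 := by
      have h := Q_S false false f
      rw [S_eq_zero_of_formDegree_eq_zero h1, h1, ← hGF, e1] at h
      simpa [eq_comm] using h
    refine eq_zero_of_eigenvalue_neg (iSup_eigenspace_T false) (neg_one_lt_zero (R := ℝ)) ?_
    rw [T_Q, e2]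
    simp
  · refine le_of_forall_bihomogeneous (fun i F => T_mem_cocycles i) fun F hF k l hk hl => ?_
    obtain ⟨h1, h2, h3⟩ := mem_cocycles_iff.mp hF
    rcases Nat.eq_zero_or_pos l with rfl | hl0
    · have hk1 : (0 : ℝ) < k + 1 := by positivity
      refine (Submodule.smul_mem_iff _ hk1.ne').mp ?_
      -- The homotopy coefficient (k-l)(l+p-1) vanishes for p = 1 and l = 0, so the split comes from
      -- the anticommutator of Q_Y and S_Y instead, equal to k + 1 here. The first summand is the
      -- representative, the second is exact.
      have e : ((k : ℝ) + 1) • F = Q d false (S d false F) + S d false (Q d false F) := by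
        rw [Q_S, hk, h1]
        simp
        module
      rw [e]
      refine Submodule.add_mem_sup (Submodule.mem_map_of_mem ?_) ?_
      · refine mem_cocycles_iff.mpr ⟨?_, by simp [T_S, h2], by simp [Q_S, h2, h3]⟩
        rw [formDegree_S, h1]
        simp
      · exact S_Q_mem_coboundaries (p := 0) hF hk hl (by simpa using hk1)
    · have hl1 : (0 : ℝ) < l := by exact_mod_cast hl0
      by_cases h0 : F = 0
      · rw [h0]; exact zero_mem _
      rcases (le_of_mem_V hF.1 hk hl h0).lt_or_eq with hlk | hlk
      · exact Submodule.mem_sup_right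
          (mem_coboundaries_of_lt (p := 0) hF hk hl hlk (by simpa using hl1))
      · exfalso
        rw [← hlk] at hk
        -- For a one-form, S_Y S_Z F would have form degree -1, so the left side is zero, while the
        -- coefficient on the right is nonzero because l > 0.
        have h := Q_Q_S_S h2 hk hl h1 h3 (Q_false_eq_zero hF hk hl)
        have hS : S d false (S d true F) = 0 :=
          S_eq_zero_of_formDegree_eq_zero (by rw [formDegree_S, h1]; simp) false
        rw [hS, map_zero, map_zero, eq_comm, smul_eq_zero] at h
        refine h.elim (fun h => ?_) h0
        have : 0 < ((l : ℝ) + (1 : ℕ) - 1) * (l + (1 : ℕ)) := by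
          push_cast
          exact mul_pos (by linarith) (by linarith)
        linarith

theorem mem_rectangularForms_iff {q : ℕ} :
    F ∈ rectangularForms d q ↔
      ∃ C ∈ V d q, T d false false C = T d true true C ∧ Q d false (Q d true C) = F := by
  constructor
  · rintro ⟨C, ⟨h1, h2⟩, rfl⟩
    rw [SetLike.mem_coe, LinearMap.mem_ker, t0_eq, LinearMap.sub_apply, sub_eq_zero] at h2
    exact ⟨C, h1, h2, rfl⟩
  · rintro ⟨C, h1, h2, rfl⟩
    refine ⟨C, ⟨h1, ?_⟩, rfl⟩
    rw [SetLike.mem_coe, LinearMap.mem_ker, t0_eq, LinearMap.sub_apply, sub_eq_zero, h2]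

theorem Q_true_Q_true (F : Forms d) : Q d true (Q d true F) = 0 := sigmaMinus_sq d F

theorem represents_add_two (q : ℕ) : Represents d (q + 2) (rectangularForms d q) := by
  refine represents_of ?_ ?_ ?_
  · intro F hF
    obtain ⟨C, hC, -, rfl⟩ := mem_rectangularForms_iff.mp hF
    obtain ⟨h1, h2⟩ := mem_V_iff.mp hC
    refine mem_cocycles_iff.mpr ⟨?_, ?_, ?_⟩
    · rw [formDegree_Q, formDegree_Q, h1]
      simp
      module
    · simp [T_Q, h2, Q_true_Q_true]
    · simp [Q_Q true false, Q_true_Q_true]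
  · have h1 : rectangularForms d q ≤ (t0 d).eigenspace 0 := by
      intro F hF
      obtain ⟨C, hC, hC0, rfl⟩ := mem_rectangularForms_iff.mp hF
      rw [Module.End.mem_eigenspace_iff, t0_eq, LinearMap.sub_apply, zero_smul]
      simp [T_Q, hC0]
    have h2 : coboundaries d (q + 2) ≤ ⨆ (μ : ℝ) (_ : μ ≠ 0), (t0 d).eigenspace μ := by
      refine Submodule.map_le_iff_le_comap.mpr ?_
      refine le_of_forall_bihomogeneous (fun i F => T_mem_V i) fun F hF k l hk hl => ?_
      rw [Submodule.mem_comap]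
      by_cases h0 : F = 0
      · rw [h0, map_zero]; exact zero_mem _
      have hlk := le_of_mem_V hF hk hl h0
      -- `sigmaMinus` lowers the Z-degree by one, which raises the weight k - l ≥ 0 to a positive
      -- one.
      refine Submodule.mem_iSup_of_mem ((k : ℝ) - l + 1)
        (Submodule.mem_iSup_of_mem (by linarith) ?_)
      rw [Module.End.mem_eigenspace_iff, t0_eq, LinearMap.sub_apply, sigmaMinus_eq, T_Q, T_Q, hk, hl]
      simp
      module
    exact ((t0 d).eigenspaces_iSupIndep 0).mono h1 h2
  · refine le_of_forall_bihomogeneous (fun i F => T_mem_cocycles i) fun F hF k l hk hl => ?_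
    obtain ⟨h1, h2, h3⟩ := mem_cocycles_iff.mp hF
    by_cases h0 : F = 0
    · rw [h0]; exact zero_mem _
    rcases (le_of_mem_V hF.1 hk hl h0).lt_or_eq with hlk | hlk
    · exact Submodule.mem_sup_right
        (mem_coboundaries_of_lt (p := q + 1) hF hk hl hlk (by positivity))
    · rw [← hlk] at hk
      have h := Q_Q_S_S h2 hk hl h1 h3 (Q_false_eq_zero hF hk hl)
      have hne : -(((l : ℝ) + (q + 2 : ℕ) - 1) * (l + (q + 2 : ℕ))) ≠ 0 := by
        have : 0 < ((l : ℝ) + (q + 2 : ℕ) - 1) * (l + (q + 2 : ℕ)) := by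
          push_cast
          refine mul_pos ?_ (by positivity)
          have : (0 : ℝ) ≤ l + q := by positivity
          linarith
        linarith
      refine Submodule.mem_sup_left ((Submodule.smul_mem_iff _ hne).mp ?_)
      rw [← h]
      -- The witness, read off from `Q_Q_S_S`, is S_Y S_Z F, with both row degrees l + 1.
      refine mem_rectangularForms_iff.mpr ⟨_, mem_V_iff.mpr ⟨?_, ?_⟩, ?_, rfl⟩
      · rw [formDegree_S, formDegree_S, h1]
        simp
        module
      · have hyy : S d false (S d false F) = 0 := by
          have h2 : (2 : ℝ) • S d false (S d false F) = 0 := by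
            rw [two_smul]
            nth_rewrite 1 [S_S]
            exact neg_add_cancel _
          exact (smul_eq_zero.mp h2).resolve_left two_ne_zero
        simp [T_S, h2, hyy]
      · simp [T_S, hk, hl]

end Representatives

end TwoRow

end

theorem mainTheorem2 (d : ℕ) :
    TwoRow.Represents d 0 (TwoRow.symmetricZeroForms d) ∧
    TwoRow.Represents d 1 (TwoRow.symmetricOneForms d) ∧
    ∀ p : ℕ, 1 < p → TwoRow.Represents d p (TwoRow.rectangularForms d (p - 2)) := by
  refine ⟨TwoRow.represents_zero, TwoRow.represents_one, fun p hp => ?_⟩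
  obtain ⟨q, rfl⟩ := Nat.exists_eq_add_of_le' hp
  exact TwoRow.represents_add_two q
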